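/- Let $n$ be a positive integer, $\mathbb{F}_q$ a finite field, and $\theta:\mathbb{F}_q^+\to\mathbb{C}^\times$ a nontrivial homomorphism. Put $[[n]]=\{(i,j):1\le i<j\le n\}$. Let $\mathcal{P}\subseteq[[n]]$ be a poset on $[n]$, i.e. $(i,j),(j,k)\in\mathcal{P}$ implies $(i,k)\in\mathcal{P}$, and suppose that $\mathcal{P}$ is normal in $[[n]]$, i.e. $(j,k)\in\mathcal{P}$ implies $(i,l)\in\mathcal{P}$ for all $1\le i\le j<k\le l\le n$. Let $U_\mathcal{P}$ be the group of upper triangular $n\times n$ matrices $g$ over $\mathbb{F}_q$ with ones on the diagonal and $g_{ij}=0$ whenever $i<j$ and $(i,j)\notin\mathcal{P}$. Let $\mathfrak{n}_\mathcal{P}=U_\mathcal{P}-1$, with dual space $\mathfrak{n}_\mathcal{P}^*$. For $\mu\in\mathfrak{n}_\mathcal{P}^*$ put $\mu_{ij}=\mu(e_{ij})$ if $(i,j)\in\mathcal{P}$ and $\mu_{ij}=0$ otherwise, and $\operatorname{supp}(\mu)=\{(i,j)\in\mathcal{P}:\mu_{ij}\ne0\}$. The group $U_\mathcal{P}$ acts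 on $\mathfrak{n}_\mathcal{P}^*$ by $(g\mu)(X)=\mu(g^{-1}X)$ and $(\mu g)(X)=\mu(Xg^{-1})$. The supercharacters of $U_\mathcal{P}$ are the functions $$\chi_\mathcal{P}^\mu(g)=\frac{|U_\mathcal{P}\mu|}{|U_\mathcal{P}\mu U_\mathcal{P}|}\sum_{\nu\in U_\mathcal{P}\mu U_\mathcal{P}}\theta(\nu(g-1)),\qquad \mu\in\mathfrak{n}_\mathcal{P}^*.$$ Let $\mathscr{S}_\mathcal{P}^*$ be the set of $\lambda\in\mathfrak{n}_\mathcal{P}^*$ such that $\operatorname{supp}(\lambda)$ has at most one position in each row and in each column. For $\lambda\in\mathscr{S}_\mathcal{P}^*$ and $\mathcal{Q}\in\{\mathcal{P},[[n]]\}$ define $$\mathrm{coadj}^{\mathrm L}_\mathcal{Q}(\lambda)=\{(j,k)\in\mathcal{P}:\exists\,(i,k)\in\operatorname{supp}(\lambda),\ (i,j)\in\mathcal{Q}\},$$ $$\mathrm{coadj}^{\mathrm R}_\mathcal{Q}(\lambda)=\{(i,j)\in\mathcal{P}:\exists\,(i,k)\in\operatorname{supp}(\lambda),\ (j,k)\in\mathcal{Q}\},$$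 let $\mathrm{coadj}_\mathcal{Q}(\lambda)$ be their union, and let $\mathrm{coaux}^{\mathrm L}(\lambda)$, $\mathrm{coaux}^{\mathrm R}(\lambda)$, $\mathrm{coaux}(\lambda)$ be the set differences $\mathrm{coadj}^{\mathrm L}_{[[n]]}(\lambda)\setminus\mathrm{coadj}^{\mathrm L}_{\mathcal{P}}(\lambda)$, $\mathrm{coadj}^{\mathrm R}_{[[n]]}(\lambda)\setminus\mathrm{coadj}^{\mathrm R}_{\mathcal{P}}(\lambda)$, $\mathrm{coadj}_{[[n]]}(\lambda)\setminus\mathrm{coadj}_{\mathcal{P}}(\lambda)$. For $\eta\in\mathfrak{n}_\mathcal{P}^*$ with $\operatorname{supp}(\eta)\subseteq\mathrm{coaux}(\lambda)$, let $\eta'$ and $\eta''$ be the parts of $\eta$ supported on $\mathrm{coaux}^{\mathrm L}(\lambda)$ and on $\mathrm{coaux}^{\mathrm R}(\lambda)\setminus\mathrm{coaux}^{\mathrm L}(\lambda)$, so that $\eta=\eta'+\eta''$, and let $\mathfrak{R}_\lambda^*(\eta)\in\mathfrak{n}_\mathcal{P}^*$ be given by $$\mathfrak{R}_\lambda^*(\eta)_{jk}=\eta'_{jk}+\eta''_{jk}+\sum_{\substack{i<j<k<l\\(i,l)\in\operatorname{supp}(\lambda)}}\eta'_{jl}\,\eta''_{ik}\,\lambda_{il}^{-1},\qquad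 (j,k)\in\mathcal{P}.$$ Let $\chi_\mathcal{P}^{(\lambda,\eta)}$ be the supercharacter indexed by $\lambda+\mathfrak{R}_\lambda^*(\eta)$. A supercharacter is called elementary if it equals $\chi_\mathcal{P}^{(\lambda,\eta)}$ for some such $\lambda,\eta$ with $|\operatorname{supp}(\lambda)|=1$. **Proposition.** Every elementary supercharacter of $U_\mathcal{P}$ is an irreducible character of $U_\mathcal{P}$, and every supercharacter of $U_\mathcal{P}$ is a (pointwise) product of finitely many elementary supercharacters. (The trivial character is the empty product.) -/

import Mathlib

/-- A poset on `[n]`: a transitive set of positions strictly above the diagonal. -/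
structure PatternPoset (n : ℕ) where
  rel : Fin n → Fin n → Prop
  lt_of_rel : ∀ {i j : Fin n}, rel i j → i < j
  trans : ∀ {i j k : Fin n}, rel i j → rel j k → rel i k

namespace PatternPoset

variable {n : ℕ}

/-- The poset of all positions strictly above the diagonal. -/
def full (n : ℕ) : PatternPoset n where
  rel i j := i < j
  lt_of_rel h := h
  trans h₁ h₂ := lt_trans h₁ h₂

/-- Normality of `P` in the full poset: `(j, k) ∈ P` implies `(i, l) ∈ P` for all
`i ≤ j < k ≤ l`. -/
def IsNormal (P : PatternPoset n) : Prop :=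
  ∀ i j k l : Fin n, i ≤ j → j < k → k ≤ l → P.rel j k → P.rel i l

/-! ### The pattern group and the pattern algebra -/

variable {F : Type*} [Field F]

/-- The condition that cuts out the pattern group: ones on the diagonal, zeros below it, and zeros
at the positions above it that do not lie in `P`. -/
def IsPatternMatrix (P : PatternPoset n) (A : Matrix (Fin n) (Fin n) F) : Prop :=
  (∀ i, A i i = 1) ∧ (∀ i j, j < i → A i j = 0) ∧ (∀ i j, i < j → ¬ P.rel i j → A i j = 0)

theorem IsPatternMatrix.eq_or_rel {P : PatternPoset n} {A : Matrix (Fin n) (Fin n) F}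
    (hA : P.IsPatternMatrix A) {i j : Fin n} (h : A i j ≠ 0) : i = j ∨ P.rel i j := by
  rcases lt_trichotomy i j with hij | hij | hij
  · by_contra hc
    push Not at hc
    exact h (hA.2.2 i j hij hc.2)
  · exact Or.inl hij
  · exact absurd (hA.2.1 i j hij) h

theorem isPatternMatrix_one (P : PatternPoset n) :
    P.IsPatternMatrix (1 : Matrix (Fin n) (Fin n) F) :=
  ⟨fun i => Matrix.one_apply_eq i, fun _ _ h => Matrix.one_apply_ne h.ne',
    fun _ _ h _ => Matrix.one_apply_ne h.ne⟩

theorem IsPatternMatrix.mul {P : PatternPoset n} {A B : Matrix (Fin n) (Fin n) F}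
    (hA : P.IsPatternMatrix A) (hB : P.IsPatternMatrix B) : P.IsPatternMatrix (A * B) := by
  have key : ∀ i j, i ≠ j → ¬ P.rel i j → (A * B) i j = 0 := by
    intro i j hij hr
    rw [Matrix.mul_apply]
    refine Finset.sum_eq_zero fun m _ => ?_
    by_contra hne
    rcases hA.eq_or_rel (left_ne_zero_of_mul hne) with h1 | h1 <;>
      rcases hB.eq_or_rel (right_ne_zero_of_mul hne) with h2 | h2
    · exact hij (h1.trans h2)
    · exact hr (h1 ▸ h2)
    · exact hr (h2 ▸ h1)
    · exact hr (P.trans h1 h2)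
  refine ⟨fun i => ?_, fun i j h => key i j h.ne' fun hr => absurd (P.lt_of_rel hr) h.asymm,
    fun i j h hr => key i j h.ne hr⟩
  rw [Matrix.mul_apply, Finset.sum_eq_single i]
  · rw [hA.1, hB.1, one_mul]
  · intro m _ hm
    by_contra hne
    rcases hA.eq_or_rel (left_ne_zero_of_mul hne) with h1 | h1
    · exact hm h1.symm
    · rcases hB.eq_or_rel (right_ne_zero_of_mul hne) with h2 | h2
      · exact hm h2
      · exact lt_irrefl _ ((P.lt_of_rel h1).trans (P.lt_of_rel h2))
  · intro h
    exact absurd (Finset.mem_univ i) h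

theorem IsPatternMatrix.pow {P : PatternPoset n} {A : Matrix (Fin n) (Fin n) F}
    (hA : P.IsPatternMatrix A) (m : ℕ) : P.IsPatternMatrix (A ^ m) := by
  induction m with
  | zero => simpa using P.isPatternMatrix_one
  | succ m ih => rw [pow_succ]; exact ih.mul hA

/-- The pattern group `U_P` over the finite field `F`. -/
def patternGroup (P : PatternPoset n) (F : Type*) [Field F] [Finite F] :
    Subgroup (GL (Fin n) F) where
  carrier := {g | P.IsPatternMatrix (g : Matrix (Fin n) (Fin n) F)}
  mul_mem' {a b} ha hb := by
    simpa using IsPatternMatrix.mul ha hb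
  one_mem' := by
    simpa using P.isPatternMatrix_one (F := F)
  inv_mem' {g} hg := by
    have h := IsPatternMatrix.pow hg (orderOf g - 1)
    have hp : g⁻¹ = g ^ (orderOf g - 1) := by
      rw [inv_eq_iff_mul_eq_one, ← pow_succ', Nat.sub_add_cancel (orderOf_pos g),
        pow_orderOf_eq_one]
    simp only [Set.mem_ofPred_eq]
    rw [hp, Units.val_pow_eq_pow_val]
    exact h

/-- The algebra `𝔫_P` of matrices supported in `P`, as a space of matrices. -/
def patternAlgebra (P : PatternPoset n) (F : Type*) [Field F] :
    Submodule F (Matrix (Fin n) (Fin n) F) where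
  carrier := {X | ∀ i j, X i j ≠ 0 → P.rel i j}
  add_mem' {X Y} hX hY i j h := by
    by_contra hr
    have h1 : X i j = 0 := by_contra fun h' => hr (hX i j h')
    have h2 : Y i j = 0 := by_contra fun h' => hr (hY i j h')
    exact h (by rw [Matrix.add_apply, h1, h2, add_zero])
  zero_mem' i j h := absurd rfl h
  smul_mem' c X hX i j h := by
    refine hX i j fun h' => h ?_
    rw [Matrix.smul_apply, h', smul_zero]

theorem mul_mem_patternAlgebra {P : PatternPoset n} {A X : Matrix (Fin n) (Fin n) F}
    (hA : P.IsPatternMatrix A) (hX : X ∈ P.patternAlgebra F) : A * X ∈ P.patternAlgebra F := by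
  intro i j h
  rw [Matrix.mul_apply] at h
  obtain ⟨m, _, hm⟩ := Finset.exists_ne_zero_of_sum_ne_zero h
  have h2 := hX m j (right_ne_zero_of_mul hm)
  rcases hA.eq_or_rel (left_ne_zero_of_mul hm) with h1 | h1
  · exact h1 ▸ h2
  · exact P.trans h1 h2

theorem mem_patternAlgebra_mul {P : PatternPoset n} {A X : Matrix (Fin n) (Fin n) F}
    (hA : P.IsPatternMatrix A) (hX : X ∈ P.patternAlgebra F) : X * A ∈ P.patternAlgebra F := by
  intro i j h
  rw [Matrix.mul_apply] at h
  obtain ⟨m, _, hm⟩ := Finset.exists_ne_zero_of_sum_ne_zero h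
  have h1 := hX i m (left_ne_zero_of_mul hm)
  rcases hA.eq_or_rel (right_ne_zero_of_mul hm) with h2 | h2
  · exact h2 ▸ h1
  · exact P.trans h1 h2

theorem sub_one_mem_patternAlgebra {P : PatternPoset n} {A : Matrix (Fin n) (Fin n) F}
    (hA : P.IsPatternMatrix A) : A - 1 ∈ P.patternAlgebra F := by
  intro i j h
  by_cases hij : i = j
  · subst hij
    exact absurd (by rw [Matrix.sub_apply, hA.1, Matrix.one_apply_eq, sub_self]) h
  · rw [Matrix.sub_apply, Matrix.one_apply_ne hij, sub_zero] at h
    exact (hA.eq_or_rel h).resolve_left hij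

theorem single_mem_patternAlgebra {P : PatternPoset n} {i j : Fin n} (h : P.rel i j) :
    Matrix.single i j (1 : F) ∈ P.patternAlgebra F := by
  intro a b hab
  by_cases hc : i = a ∧ j = b
  · exact hc.1 ▸ hc.2 ▸ h
  · exact absurd (Matrix.single_apply_of_ne (c := (1 : F)) _ _ _ _ hc) hab

/-- The dual space `𝔫_P^*`. -/
abbrev PatternDual (P : PatternPoset n) (F : Type*) [Field F] : Type _ :=
  Module.Dual F (P.patternAlgebra F)

section Supercharacters

variable [Finite F] (P : PatternPoset n)

/-- Left multiplication by `g ∈ U_P` on `𝔫_P`. -/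
def mulLeft (g : P.patternGroup F) : P.patternAlgebra F →ₗ[F] P.patternAlgebra F where
  toFun X := ⟨(g : GL (Fin n) F).val * X.1, mul_mem_patternAlgebra g.2 X.2⟩
  map_add' _ _ := Subtype.ext (Matrix.mul_add _ _ _)
  map_smul' _ _ := Subtype.ext (Matrix.mul_smul _ _ _)

/-- Right multiplication by `g ∈ U_P` on `𝔫_P`. -/
def mulRight (g : P.patternGroup F) : P.patternAlgebra F →ₗ[F] P.patternAlgebra F where
  toFun X := ⟨X.1 * (g : GL (Fin n) F).val, mem_patternAlgebra_mul g.2 X.2⟩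
  map_add' _ _ := Subtype.ext (Matrix.add_mul _ _ _)
  map_smul' _ _ := Subtype.ext (Matrix.smul_mul _ _ _)

/-- The element `g - 1` of `𝔫_P`, for `g ∈ U_P`. -/
def subOne (g : P.patternGroup F) : P.patternAlgebra F :=
  ⟨(g : GL (Fin n) F).val - 1, sub_one_mem_patternAlgebra g.2⟩

/-- The left action `(gμ)(X) = μ(g⁻¹X)` on `𝔫_P^*`. -/
def dualLeft (g : P.patternGroup F) (μ : P.PatternDual F) : P.PatternDual F :=
  μ.comp (P.mulLeft g⁻¹)

/-- The right action `(μg)(X) = μ(Xg⁻¹)` on `𝔫_P^*`. -/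
def dualRight (μ : P.PatternDual F) (g : P.patternGroup F) : P.PatternDual F :=
  μ.comp (P.mulRight g⁻¹)

/-- The orbit `U_P μ`. -/
def leftOrbit (μ : P.PatternDual F) : Set (P.PatternDual F) :=
  {ν | ∃ g : P.patternGroup F, ν = P.dualLeft g μ}

/-- The orbit `U_P μ U_P`. -/
def twoSidedOrbit (μ : P.PatternDual F) : Set (P.PatternDual F) :=
  {ν | ∃ g h : P.patternGroup F, ν = P.dualRight (P.dualLeft g μ) h}

/-- The supercharacter `χ_P^μ`, with respect to the additive character `θ`. Orbits are finite,
since `U_P` is. -/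
noncomputable def superchar (θ : AddChar F ℂ) (μ : P.PatternDual F) :
    P.patternGroup F → ℂ := fun g =>
  ((P.leftOrbit μ).ncard : ℂ) / ((P.twoSidedOrbit μ).ncard : ℂ) *
    ∑ᶠ ν ∈ P.twoSidedOrbit μ, θ (ν (P.subOne g))

/-- A function on `U_P` is a supercharacter if it is `χ_P^μ` for some `μ ∈ 𝔫_P^*`. -/
def IsSupercharacter (θ : AddChar F ℂ) (χ : P.patternGroup F → ℂ) : Prop :=
  ∃ μ : P.PatternDual F, χ = P.superchar θ μ

end Supercharacters

/-! ### Coordinates on the dual space -/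

section Coordinates

variable (P : PatternPoset n)

open scoped Classical in
/-- The entry `μ_{ij}`: it is `μ(e_{ij})` for `(i, j) ∈ P`, and `0` otherwise. -/
noncomputable def entry (μ : P.PatternDual F) (i j : Fin n) : F :=
  if h : P.rel i j then μ ⟨Matrix.single i j 1, single_mem_patternAlgebra h⟩ else 0

/-- The functional on `𝔫_P` whose `(i, j)` entry is `M i j` for every `(i, j) ∈ P`. -/
def ofEntries (M : Fin n → Fin n → F) : P.PatternDual F where
  toFun X := ∑ i, ∑ j, M i j * X.1 i j
  map_add' X Y := by
    simp only [Submodule.coe_add, Matrix.add_apply, mul_add, Finset.sum_add_distrib]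
  map_smul' c X := by
    simp only [Submodule.coe_smul, Matrix.smul_apply, smul_eq_mul, Finset.mul_sum,
      RingHom.id_apply]
    exact Finset.sum_congr rfl fun i _ => Finset.sum_congr rfl fun j _ => by ring

theorem entry_ofEntries (M : Fin n → Fin n → F) {i j : Fin n} (h : P.rel i j) :
    P.entry (P.ofEntries M) i j = M i j := by
  rw [entry, dif_pos h]
  change ∑ a, ∑ b, M a b * Matrix.single i j (1 : F) a b = M i j
  rw [Finset.sum_eq_single i, Finset.sum_eq_single j]
  · simp
  · intro b _ hb
    simp [hb.symm]
  · simp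
  · intro a _ ha
    simp [ha.symm]
  · simp

/-- The support of a functional, a set of positions in `P`. -/
def supp (μ : P.PatternDual F) : Set (Fin n × Fin n) :=
  {p | P.rel p.1 p.2 ∧ P.entry μ p.1 p.2 ≠ 0}

/-- `𝒮_P^*`: the functionals whose support has at most one position in each row and column. -/
def IsSetPartition (lam : P.PatternDual F) : Prop :=
  ∀ p ∈ P.supp lam, ∀ q ∈ P.supp lam, p.1 = q.1 ∨ p.2 = q.2 → p = q

/-- `coadj_Q^L(λ)`. -/
def coadjL (Q : PatternPoset n) (lam : P.PatternDual F) : Set (Fin n × Fin n) :=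
  {p | P.rel p.1 p.2 ∧ ∃ i, (i, p.2) ∈ P.supp lam ∧ Q.rel i p.1}

/-- `coadj_Q^R(λ)`. -/
def coadjR (Q : PatternPoset n) (lam : P.PatternDual F) : Set (Fin n × Fin n) :=
  {p | P.rel p.1 p.2 ∧ ∃ k, (p.1, k) ∈ P.supp lam ∧ Q.rel p.2 k}

/-- `coadj_Q(λ)`. -/
def coadj (Q : PatternPoset n) (lam : P.PatternDual F) : Set (Fin n × Fin n) :=
  P.coadjL Q lam ∪ P.coadjR Q lam

/-- `coaux_P^L(λ)`. -/
def coauxL (lam : P.PatternDual F) : Set (Fin n × Fin n) :=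
  P.coadjL (full n) lam \ P.coadjL P lam

/-- `coaux_P^R(λ)`. -/
def coauxR (lam : P.PatternDual F) : Set (Fin n × Fin n) :=
  P.coadjR (full n) lam \ P.coadjR P lam

/-- `coaux_P(λ)`. -/
def coaux (lam : P.PatternDual F) : Set (Fin n × Fin n) :=
  P.coadj (full n) lam \ P.coadj P lam

open scoped Classical in
/-- The functional with the entries of `η` at the positions in `S`, and zeros elsewhere. -/
noncomputable def part (S : Set (Fin n × Fin n)) (η : P.PatternDual F) : P.PatternDual F :=
  P.ofEntries fun i j => if (i, j) ∈ S then P.entry η i j else 0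

open scoped Classical in
/-- The product `η *_λ μ`. -/
noncomputable def starProd (lam η μ : P.PatternDual F) : P.PatternDual F :=
  P.ofEntries fun j k => P.entry η j k + P.entry μ j k +
    ∑ i, ∑ l, if i < j ∧ j < k ∧ k < l ∧ (i, l) ∈ P.supp lam then
      P.entry η j l * P.entry μ i k * (P.entry lam i l)⁻¹ else 0

/-- The functional `ℜ_λ^*(η) = η_L *_λ η_{R∖L}`. When `supp η ⊆ coaux_P(λ)`, `η` is the sum of its
parts `η_L` on `coaux_P^L(λ)` and `η_{R∖L}` on `coaux_P^R(λ) ∖ coaux_P^L(λ)`. -/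
noncomputable def rep (lam η : P.PatternDual F) : P.PatternDual F :=
  P.starProd lam (P.part (P.coauxL lam) η) (P.part (P.coauxR lam \ P.coauxL lam) η)

variable [Finite F]

/-- A function on `U_P` is an elementary supercharacter if it is `χ_P^{(λ,η)}`, the supercharacter
indexed by `λ + ℜ_λ^*(η)`, for some `λ ∈ 𝒮_P^*` with `|supp λ| = 1` and some `η` with
`supp η ⊆ coaux_P(λ)`. -/
def IsElementary (θ : AddChar F ℂ) (χ : P.patternGroup F → ℂ) : Prop :=
  ∃ lam η : P.PatternDual F, P.IsSetPartition lam ∧ (P.supp lam).ncard = 1 ∧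
    P.supp η ⊆ P.coaux lam ∧ χ = P.superchar θ (lam + P.rep lam η)

end Coordinates

end PatternPoset

/-- `χ` is the character of an irreducible complex representation of finite dimension. -/
def IsIrreducibleCharacter {G : Type*} [Group G] (χ : G → ℂ) : Prop :=
  ∃ (d : ℕ) (ρ : Representation ℂ G (Fin d → ℂ)), ρ.IsIrreducible ∧
    ∀ g, χ g = LinearMap.trace ℂ (Fin d → ℂ) (ρ g)

/-! Averaging `θ (ν (h - 1))` over right translates of `ν` leaves `θ (ν (h - 1))` if `h` fixes `ν`
on the left and `0` otherwise. Hence `χ^μ(h)` is the sum of `θ (ν (h - 1))` over those `ν` in the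
left orbit of `μ` that `h` fixes (`superchar_eq_finsum`). This is the trace of a monomial
representation on functions on that orbit, and it is irreducible as soon as any two distinct points
of the orbit are told apart by an element fixing both.

The functionals defining elementary supercharacters have rank one: they are `X ↦ uᵀ X v`
(`add_rep_eq_rankOne`). The left action changes only `u`. If `b` is the last index with `v b ≠ 0`,
normality makes the entries in column `b` determine the functional, and elements `1 + s e_{jb}`
separate any two orbit points (`isIrreducibleCharacter_rankOne`).

For the factorization, write `μ` as a matrix of entries, take its last nonzero column `b` and the
topmost nonzero entry `(a, b)` there, and subtract the rank one matrix agreeing with it on row `a`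
and column `b`. The remainder vanishes on this row and column. This makes the left orbit of the sum
the direct sum of the two left orbits, so the supercharacter splits as a product
(`superchar_rankOne_add`). If `(a, b) ∈ P`, elimination by the two actions turns the rank one factor
into an elementary one (`isElementary_rankOne`); otherwise normality makes it zero. Induction on the
number of columns finishes the proof. -/

open scoped Classical in
/-- Summing a function over a group along a map with equivariant fibres. -/
theorem sum_comp_mul_ncard_range {G X R : Type*} [Group G] [Fintype G] [CommSemiring R] (φ : G → X)
    (hφ : ∀ k g g', φ g = φ g' → φ (k * g) = φ (k * g')) (f : X → R) :
    (∑ g, f (φ g)) * ((Set.range φ).ncard : R) =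
      (Fintype.card G : R) * ∑ᶠ x ∈ Set.range φ, f x := by
  -- All nonempty fibres have the same size, since translation by `g₀` carries the fibre of `φ 1`
  -- onto that of `φ g₀`.
  have hfib : ∀ x ∈ Finset.univ.image φ,
      (Finset.univ.filter fun g => φ g = x).card = (Finset.univ.filter fun g => φ g = φ 1).card := by
    intro x hx
    obtain ⟨g₀, -, rfl⟩ := Finset.mem_image.1 hx
    refine Finset.card_bij' (fun g _ => g₀⁻¹ * g) (fun g _ => g₀ * g) ?_ ?_ ?_ ?_
    · intro g hg
      simp only [Finset.mem_filter, Finset.mem_univ, true_and] at hg ⊢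
      simpa using hφ g₀⁻¹ _ _ hg
    · intro g hg
      simp only [Finset.mem_filter, Finset.mem_univ, true_and] at hg ⊢
      simpa using hφ g₀ _ _ hg
    · simp
    · simp
  have hsum : ∀ f : X → R, ∑ g, f (φ g) =
      ((Finset.univ.filter fun g => φ g = φ 1).card : R) * ∑ x ∈ Finset.univ.image φ, f x := by
    intro f
    rw [Finset.sum_comp f φ, Finset.mul_sum]
    exact Finset.sum_congr rfl fun x hx => by rw [hfib x hx, nsmul_eq_mul]
  have hrange : Set.range φ = ↑(Finset.univ.image φ) := by simp
  have hcard : (Fintype.card G : R) = ((Finset.univ.filter fun g => φ g = φ 1).card : R) *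
      ((Finset.univ.image φ).card : R) := by
    have := hsum fun _ => 1
    simpa using this
  rw [hrange, Set.ncard_coe_finset, finsum_mem_coe_finset, hsum, hcard]
  ring

/-! ### Monomial representations and their irreducibility -/

section Monomial

variable {G ι : Type*} [Group G]

/-- The monomial representation on `ι → ℂ` given by a permutation action and a cocycle. -/
def monomialRepresentation (σ : G →* Equiv.Perm ι) (α : G → ι → ℂ) (h₁ : ∀ i, α 1 i = 1)
    (hα : ∀ g h i, α (g * h) i = α g i * α h (σ g⁻¹ i)) : Representation ℂ G (ι → ℂ) where
  toFun g :=
    { toFun f i := α g i * f (σ g⁻¹ i)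
      map_add' f f' := by ext i; simp [mul_add]
      map_smul' c f := by ext i; simp [mul_left_comm] }
  map_one' := by ext f i; simp [h₁]
  map_mul' g h := by ext f i; simp [hα, mul_assoc]

variable (σ : G →* Equiv.Perm ι) (α : G → ι → ℂ) (h₁ : ∀ i, α 1 i = 1)
    (hα : ∀ g h i, α (g * h) i = α g i * α h (σ g⁻¹ i))

theorem monomialRepresentation_apply (g : G) (f : ι → ℂ) (i : ι) :
    monomialRepresentation σ α h₁ hα g f i = α g i * f (σ g⁻¹ i) := rfl

open scoped Classical in
theorem trace_monomialRepresentation [Fintype ι] (g : G) :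
    LinearMap.trace ℂ (ι → ℂ) (monomialRepresentation σ α h₁ hα g) =
      ∑ i, if σ g i = i then α g i else 0 := by
  rw [LinearMap.trace_eq_matrix_trace ℂ (Pi.basisFun ℂ ι), Matrix.trace]
  refine Finset.sum_congr rfl fun i _ => ?_
  rw [Matrix.diag_apply, LinearMap.toMatrix_apply]
  simp only [Pi.basisFun_apply, Pi.basisFun_repr, monomialRepresentation_apply]
  have : σ g⁻¹ i = i ↔ σ g i = i := by
    rw [map_inv, Equiv.Perm.inv_eq_iff_eq, eq_comm]
  by_cases h : σ g i = i
  · rw [this.2 h, if_pos h, Pi.single_eq_same, mul_one]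
  · rw [if_neg h, Pi.single_eq_of_ne (fun h' => h (this.1 h')), mul_zero]

/-- Averaging a vector of an invariant subspace over the stabilizer of `i`, twisted by the character
`α · i`, projects it to a multiple of the basis vector at `i`: a separating element kills every
other coordinate. Transitivity then yields all the basis vectors. -/
theorem monomialRepresentation_isIrreducible [Finite G] [Finite ι] [Nonempty ι]
    (htrans : ∀ i j, ∃ g, σ g i = j)
    (hsep : ∀ i j, i ≠ j → ∃ g, σ g i = i ∧ σ g j = j ∧ α g i ≠ α g j) :
    (monomialRepresentation σ α h₁ hα).IsIrreducible := by
  classical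
  cases nonempty_fintype G
  cases nonempty_fintype ι
  set ρ := monomialRepresentation σ α h₁ hα with hρ
  have hne : ∀ g i, α g i ≠ 0 := by
    intro g i h
    have := hα g g⁻¹ i
    rw [mul_inv_cancel, h₁, h, zero_mul] at this
    exact one_ne_zero this
  have hsmall : ∀ W : Subrepresentation ρ, W ≠ ⊥ → W = ⊤ := by
    intro W hW
    obtain ⟨f, hfW, hf⟩ : ∃ f ∈ W, f ≠ 0 := by
      by_contra! hc
      refine hW (le_antisymm (fun x hx => ?_) bot_le)
      rw [hc x hx]
      exact (⊥ : Subrepresentation ρ).toSubmodule.zero_mem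
    obtain ⟨i, hi⟩ := Function.ne_iff.1 hf
    let H : Finset G := Finset.univ.filter fun g => σ g i = i
    have hH : ∀ g, g ∈ H ↔ σ g i = i := fun g => by simp [H]
    have hHinv : ∀ g ∈ H, σ g⁻¹ i = i := by
      intro g hg
      rw [map_inv, Equiv.Perm.inv_eq_iff_eq, (hH g).1 hg]
    let e : ι → ℂ := ∑ h ∈ H, (α h i)⁻¹ • ρ h f
    have heW : e ∈ W.toSubmodule :=
      Submodule.sum_mem _ fun h _ => Submodule.smul_mem _ _ (W.apply_mem_toSubmodule h hfW)
    have hei : e i = (H.card : ℂ) * f i := by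
      simp only [e, Finset.sum_apply, Pi.smul_apply, smul_eq_mul]
      rw [← nsmul_eq_mul, ← Finset.sum_const]
      refine Finset.sum_congr rfl fun h hh => ?_
      rw [hρ, monomialRepresentation_apply, hHinv h hh, inv_mul_cancel_left₀ (hne h i)]
    have hinv : ∀ g ∈ H, ρ g e = α g i • e := by
      intro g hg
      simp only [e, map_sum, map_smul, Finset.smul_sum]
      refine Finset.sum_bij' (fun h _ => g * h) (fun h _ => g⁻¹ * h) ?_ ?_ ?_ ?_ ?_
      · intro h hh
        rw [hH, map_mul, Equiv.Perm.mul_apply, (hH h).1 hh, (hH g).1 hg]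
      · intro h hh
        rw [hH, map_mul, Equiv.Perm.mul_apply, (hH h).1 hh, hHinv g hg]
      · simp
      · simp
      · intro h hh
        rw [hα, hHinv g hg, map_mul, Module.End.mul_apply, smul_smul, mul_inv,
          mul_inv_cancel_left₀ (hne g i)]
    -- A `g` fixing `i` and `j` multiplies coordinate `j` of `e` by `α g j`, while `e` is an
    -- eigenvector with eigenvalue `α g i`; these differ.
    have hej : ∀ j, j ≠ i → e j = 0 := by
      intro j hj
      obtain ⟨g, hgj, hgi, hg⟩ := hsep j i hj
      have h := congrFun (hinv g ((hH g).2 hgi)) j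
      rw [hρ, monomialRepresentation_apply, map_inv, (Equiv.Perm.inv_eq_iff_eq).2 hgj.symm,
        Pi.smul_apply, smul_eq_mul] at h
      by_contra h0
      exact hg (mul_right_cancel₀ h0 h)
    have hc : (H.card : ℂ) ≠ 0 :=
      Nat.cast_ne_zero.2 (Finset.card_ne_zero_of_mem ((hH 1).2 (by simp)))
    have hsingle : ∀ j, (Pi.single j 1 : ι → ℂ) ∈ W.toSubmodule := by
      intro j
      obtain ⟨g, hg⟩ := htrans i j
      have h2 : (Pi.single j 1 : ι → ℂ) = (α g j * e i)⁻¹ • ρ g e := by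
        ext k
        rw [Pi.smul_apply, hρ, monomialRepresentation_apply, smul_eq_mul]
        by_cases hk : k = j
        · have : σ g⁻¹ k = i := by rw [map_inv, Equiv.Perm.inv_eq_iff_eq, hk, hg]
          rw [this, hk, Pi.single_eq_same, inv_mul_cancel₀]
          exact mul_ne_zero (hne g j) (by rw [hei]; exact mul_ne_zero hc hi)
        · have : e (σ g⁻¹ k) = 0 := by
            refine hej _ fun h => hk ?_
            rwa [map_inv, Equiv.Perm.inv_eq_iff_eq, hg] at h
          rw [Pi.single_eq_of_ne hk, this, mul_zero, mul_zero]
      rw [h2]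
      exact Submodule.smul_mem _ _ (W.apply_mem_toSubmodule g heW)
    refine le_antisymm le_top fun x _ => ?_
    change x ∈ W.toSubmodule
    rw [pi_eq_sum_univ' x]
    refine Submodule.sum_mem _ fun j _ => Submodule.smul_mem _ _ ?_
    convert hsingle j using 1
  have hnt : Nontrivial (Subrepresentation ρ) := by
    refine ⟨⊥, ⊤, fun h => ?_⟩
    obtain ⟨i⟩ := ‹Nonempty ι›
    have h3 : (Pi.single i 1 : ι → ℂ) ∈ (⊤ : Subrepresentation ρ).toSubmodule := trivial
    rw [← h] at h3
    have h4 : (Pi.single i 1 : ι → ℂ) = 0 := h3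
    exact one_ne_zero (by simpa using congrFun h4 i : (1 : ℂ) = 0)
  exact { eq_bot_or_eq_top := fun W => or_iff_not_imp_left.2 (hsmall W) }

end Monomial

namespace PatternPoset

variable {n : ℕ} {F : Type*} [Field F]

theorem det_eq_one_of_isPatternMatrix {P : PatternPoset n} {A : Matrix (Fin n) (Fin n) F}
    (hA : P.IsPatternMatrix A) : A.det = 1 := by
  rw [Matrix.det_of_isUpperTriangular fun i j h => hA.2.1 i j h]
  exact Finset.prod_eq_one fun i _ => hA.1 i

theorem isPatternMatrix_one_add {P : PatternPoset n} {Y : Matrix (Fin n) (Fin n) F}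
    (hY : Y ∈ P.patternAlgebra F) : P.IsPatternMatrix (1 + Y) := by
  have h0 : ∀ i j, ¬ P.rel i j → Y i j = 0 := fun i j h => by_contra fun h' => h (hY i j h')
  refine ⟨fun i => ?_, fun i j h => ?_, fun i j h h' => ?_⟩
  · rw [Matrix.add_apply, Matrix.one_apply_eq, h0 i i fun h => (P.lt_of_rel h).false, add_zero]
  · rw [Matrix.add_apply, Matrix.one_apply_ne h.ne', h0 i j fun h' => (P.lt_of_rel h').asymm h,
      add_zero]
  · rw [Matrix.add_apply, Matrix.one_apply_ne h.ne, h0 i j h', add_zero]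

/-! ### Actions on the dual space, and supercharacters as sums over left orbits -/

section Group

variable [Finite F] (P : PatternPoset n)

/-- The element `1 + Y` of `U_P`, for `Y ∈ 𝔫_P`. -/
noncomputable def oneAdd (Y : P.patternAlgebra F) : P.patternGroup F :=
  ⟨Matrix.GeneralLinearGroup.mkOfDetNeZero (1 + Y.1)
    (by rw [det_eq_one_of_isPatternMatrix (isPatternMatrix_one_add Y.2)]; exact one_ne_zero),
    isPatternMatrix_one_add Y.2⟩

theorem coe_oneAdd (Y : P.patternAlgebra F) :
    ((P.oneAdd Y : P.patternGroup F) : GL (Fin n) F).val = 1 + Y.1 := rfl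

/-- The bijection `Y ↦ 1 + Y` from `𝔫_P` to `U_P`. -/
noncomputable def oneAddEquiv : P.patternAlgebra F ≃ P.patternGroup F where
  toFun := P.oneAdd
  invFun := P.subOne
  left_inv Y := Subtype.ext (by simp [subOne, coe_oneAdd])
  right_inv g := Subtype.ext (Units.ext (by simp [subOne, coe_oneAdd]))

theorem subOne_oneAdd (Y : P.patternAlgebra F) : P.subOne (P.oneAdd Y) = Y :=
  P.oneAddEquiv.left_inv Y

theorem mulLeft_one : P.mulLeft (1 : P.patternGroup F) = LinearMap.id :=
  LinearMap.ext fun X => Subtype.ext (by simp [mulLeft])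

theorem mulLeft_mul (g h : P.patternGroup F) :
    P.mulLeft (g * h) = (P.mulLeft g).comp (P.mulLeft h) :=
  LinearMap.ext fun X => Subtype.ext (by simp [mulLeft, Matrix.mul_assoc])

theorem mulRight_one : P.mulRight (1 : P.patternGroup F) = LinearMap.id :=
  LinearMap.ext fun X => Subtype.ext (by simp [mulRight])

theorem mulRight_mul (g h : P.patternGroup F) :
    P.mulRight (g * h) = (P.mulRight h).comp (P.mulRight g) :=
  LinearMap.ext fun X => Subtype.ext (by simp [mulRight, Matrix.mul_assoc])

theorem dualLeft_one (μ : P.PatternDual F) : P.dualLeft 1 μ = μ := by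
  rw [dualLeft, inv_one, mulLeft_one, LinearMap.comp_id]

theorem dualLeft_mul (g h : P.patternGroup F) (μ : P.PatternDual F) :
    P.dualLeft (g * h) μ = P.dualLeft g (P.dualLeft h μ) := by
  rw [dualLeft, mul_inv_rev, mulLeft_mul]; rfl

theorem dualLeft_add (g : P.patternGroup F) (μ ν : P.PatternDual F) :
    P.dualLeft g (μ + ν) = P.dualLeft g μ + P.dualLeft g ν := rfl

theorem dualRight_one (μ : P.PatternDual F) : P.dualRight μ 1 = μ := by
  rw [dualRight, inv_one, mulRight_one, LinearMap.comp_id]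

theorem dualRight_mul (μ : P.PatternDual F) (g h : P.patternGroup F) :
    P.dualRight μ (g * h) = P.dualRight (P.dualRight μ g) h := by
  rw [dualRight, mul_inv_rev, mulRight_mul]; rfl

theorem dualLeft_dualRight (μ : P.PatternDual F) (g h : P.patternGroup F) :
    P.dualLeft g (P.dualRight μ h) = P.dualRight (P.dualLeft g μ) h :=
  LinearMap.ext fun X => congrArg μ (Subtype.ext (by simp [mulLeft, mulRight, Matrix.mul_assoc]))

theorem dualRight_injective (g : P.patternGroup F) :
    Function.Injective fun μ : P.PatternDual F => P.dualRight μ g := fun μ ν h => by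
  have h' : P.dualRight μ g = P.dualRight ν g := h
  rw [← P.dualRight_one μ, ← P.dualRight_one ν, ← mul_inv_cancel g, dualRight_mul, dualRight_mul,
    h']

theorem dualLeft_mem_leftOrbit (g : P.patternGroup F) {μ ν : P.PatternDual F}
    (h : ν ∈ P.leftOrbit μ) : P.dualLeft g ν ∈ P.leftOrbit μ := by
  obtain ⟨k, rfl⟩ := h
  exact ⟨g * k, (P.dualLeft_mul g k μ).symm⟩

theorem mem_leftOrbit_iff {μ ν : P.PatternDual F} :
    ν ∈ P.leftOrbit μ ↔ ∃ g : P.patternGroup F, ν = μ.comp (P.mulLeft g) :=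
  ⟨fun ⟨g, hg⟩ => ⟨g⁻¹, hg⟩, fun ⟨g, hg⟩ => ⟨g⁻¹, by rw [hg, dualLeft, inv_inv]⟩⟩

theorem leftOrbit_dualLeft (g : P.patternGroup F) (μ : P.PatternDual F) :
    P.leftOrbit (P.dualLeft g μ) = P.leftOrbit μ := by
  ext ν
  constructor
  · rintro ⟨k, rfl⟩
    exact ⟨k * g, (P.dualLeft_mul k g μ).symm⟩
  · rintro ⟨k, rfl⟩
    exact ⟨k * g⁻¹, by rw [← dualLeft_mul, inv_mul_cancel_right]⟩

theorem leftOrbit_dualRight (g : P.patternGroup F) (μ : P.PatternDual F) :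
    P.leftOrbit (P.dualRight μ g) = (fun ν => P.dualRight ν g) '' P.leftOrbit μ := by
  ext ν
  constructor
  · rintro ⟨k, rfl⟩
    exact ⟨_, ⟨k, rfl⟩, (P.dualLeft_dualRight μ k g).symm⟩
  · rintro ⟨_, ⟨k, rfl⟩, rfl⟩
    exact ⟨k, (P.dualLeft_dualRight μ k g).symm⟩

theorem superchar_dualLeft (θ : AddChar F ℂ) (g : P.patternGroup F) (μ : P.PatternDual F) :
    P.superchar θ (P.dualLeft g μ) = P.superchar θ μ := by
  have h : P.twoSidedOrbit (P.dualLeft g μ) = P.twoSidedOrbit μ := by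
    ext ν
    constructor
    · rintro ⟨k, l, rfl⟩
      exact ⟨k * g, l, by rw [dualLeft_mul]⟩
    · rintro ⟨k, l, rfl⟩
      exact ⟨k * g⁻¹, l, by rw [← dualLeft_mul, inv_mul_cancel_right]⟩
  funext x
  rw [superchar, superchar, h, leftOrbit_dualLeft]

theorem superchar_dualRight (θ : AddChar F ℂ) (g : P.patternGroup F) (μ : P.PatternDual F) :
    P.superchar θ (P.dualRight μ g) = P.superchar θ μ := by
  have h : P.twoSidedOrbit (P.dualRight μ g) = P.twoSidedOrbit μ := by
    ext ν
    constructor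
    · rintro ⟨k, l, rfl⟩
      exact ⟨k, g * l, by rw [dualLeft_dualRight, ← dualRight_mul]⟩
    · rintro ⟨k, l, rfl⟩
      exact ⟨k, g⁻¹ * l, by rw [dualLeft_dualRight, ← dualRight_mul, mul_inv_cancel_left]⟩
  funext x
  rw [superchar, superchar, h, leftOrbit_dualRight,
    Set.ncard_image_of_injective _ (P.dualRight_injective g)]

theorem dualLeft_eq_self_iff (h : P.patternGroup F) (ν : P.PatternDual F) :
    P.dualLeft h ν = ν ↔ ∀ Y, ν (P.mulLeft h Y) = ν Y := by
  constructor
  · intro hν Y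
    have := LinearMap.congr_fun hν (P.mulLeft h Y)
    rw [← this, dualLeft, ← LinearMap.comp_apply, LinearMap.comp_assoc, ← mulLeft_mul,
      inv_mul_cancel, mulLeft_one, LinearMap.comp_id]
  · intro hν
    refine LinearMap.ext fun X => ?_
    rw [dualLeft, LinearMap.comp_apply, ← hν, ← LinearMap.comp_apply (P.mulLeft h), ← mulLeft_mul,
      mul_inv_cancel, mulLeft_one, LinearMap.id_apply]

theorem subOne_mul (g h : P.patternGroup F) :
    P.subOne (g * h) = P.subOne g + P.mulLeft g (P.subOne h) :=
  Subtype.ext (by simp [subOne, mulLeft, mul_sub])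

theorem subOne_mul' (g h : P.patternGroup F) :
    P.subOne (g * h) = P.subOne h + P.mulRight h (P.subOne g) :=
  Subtype.ext (by simp [subOne, mulRight, sub_mul])

open scoped Classical in
/-- The contribution of `ν ∈ U_P μ` to the value of `χ_P^μ` at `h`. -/
noncomputable def fixedTerm (θ : AddChar F ℂ) (h : P.patternGroup F) (ν : P.PatternDual F) : ℂ :=
  if P.dualLeft h ν = ν then θ (ν (P.subOne h)) else 0

instance : Finite (P.PatternDual F) :=
  Finite.of_injective (fun ν : P.PatternDual F => (ν : P.patternAlgebra F → F)) DFunLike.coe_injective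

/-- Writing `k = 1 + Y`, the summand is `θ (ν (h - 1))` times the additive character `Y ↦ θ (ν (hY)
- ν Y)`, which is trivial exactly when `h` fixes `ν`; orthogonality gives the sum. -/
theorem sum_dualRight_inv (θ : AddChar F ℂ) (hθ : θ ≠ 1) [Fintype (P.patternGroup F)]
    (h : P.patternGroup F) (ν : P.PatternDual F) :
    ∑ k : P.patternGroup F, θ (P.dualRight ν k⁻¹ (P.subOne h)) =
      (Fintype.card (P.patternGroup F) : ℂ) * P.fixedTerm θ h ν := by
  classical
  cases nonempty_fintype (P.patternAlgebra F)
  let φ : P.patternAlgebra F →ₗ[F] F := ν.comp (P.mulLeft h) - ν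
  have hsum : ∑ k : P.patternGroup F, θ (P.dualRight ν k⁻¹ (P.subOne h)) =
      θ (ν (P.subOne h)) * ∑ Y, θ.compAddMonoidHom φ.toAddMonoidHom Y := by
    rw [← P.oneAddEquiv.sum_comp, Finset.mul_sum]
    refine Finset.sum_congr rfl fun Y _ => ?_
    have : P.dualRight ν (P.oneAdd Y)⁻¹ (P.subOne h) = ν (P.subOne h) + φ Y := by
      -- Expand `h(1 + Y) - 1` in two ways.
      have h1 : P.mulRight (P.oneAdd Y) (P.subOne h) = P.subOne h + (P.mulLeft h Y - Y) := by
        have h2 := P.subOne_mul h (P.oneAdd Y)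
        rw [subOne_mul', subOne_oneAdd] at h2
        rw [eq_sub_of_add_eq' h2]
        abel
      rw [dualRight, inv_inv, LinearMap.comp_apply, h1, map_add, map_sub]
      rfl
    change θ (P.dualRight ν (P.oneAdd Y)⁻¹ (P.subOne h)) = _
    rw [this, AddChar.map_add_eq_mul]
    rfl
  rw [hsum, AddChar.sum_eq_ite, fixedTerm, Fintype.card_congr P.oneAddEquiv.symm]
  have hiff : θ.compAddMonoidHom φ.toAddMonoidHom = 0 ↔ P.dualLeft h ν = ν := by
    rw [dualLeft_eq_self_iff]
    constructor
    · intro h0 Y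
      by_contra hne
      have hφ : φ Y ≠ 0 := sub_ne_zero.2 hne
      obtain ⟨t, ht⟩ := AddChar.ne_one_iff.1 hθ
      apply ht
      -- Rescaling `Y` makes `φ` take the value `t`, where `θ t ≠ 1`.
      have := DFunLike.congr_fun h0 ((t * (φ Y)⁻¹) • Y)
      change θ (φ _) = 1 at this
      rwa [map_smul, smul_eq_mul, inv_mul_cancel_right₀ hφ] at this
    · intro h0
      ext Y
      change θ (ν (P.mulLeft h Y) - ν Y) = 1
      rw [h0, sub_self, AddChar.map_zero_eq_one]
  by_cases hc : P.dualLeft h ν = ν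
  · rw [if_pos hc, if_pos (hiff.2 hc), mul_comm]
  · rw [if_neg hc, if_neg (mt hiff.1 hc), mul_zero, mul_zero]

/-- Replace both orbit sums by sums over groups, `U_P × U_P` and `U_P`, and carry out the sum over
the right factor first; the orbit sizes in the normalization then cancel. -/
theorem superchar_eq_finsum (θ : AddChar F ℂ) (hθ : θ ≠ 1) (μ : P.PatternDual F)
    (h : P.patternGroup F) :
    P.superchar θ μ h = ∑ᶠ ν ∈ P.leftOrbit μ, P.fixedTerm θ h ν := by
  classical
  cases nonempty_fintype (P.patternGroup F)
  let φ : P.patternGroup F × P.patternGroup F → P.PatternDual F :=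
    fun x => P.dualRight (P.dualLeft x.1 μ) x.2⁻¹
  have hrange : Set.range φ = P.twoSidedOrbit μ := by
    ext ν
    constructor
    · rintro ⟨x, rfl⟩
      exact ⟨x.1, x.2⁻¹, rfl⟩
    · rintro ⟨g, k, rfl⟩
      exact ⟨(g, k⁻¹), by simp [φ]⟩
  have h1 := sum_comp_mul_ncard_range φ (fun k g g' hg => by
    have hx : ∀ g, φ (k * g) = P.dualRight (P.dualLeft k.1 (φ g)) k.2⁻¹ := fun g => by
      simp only [φ, Prod.fst_mul, Prod.snd_mul, mul_inv_rev, dualLeft_mul, dualRight_mul,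
        dualLeft_dualRight]
    rw [hx, hx, hg]) fun ν => θ (ν (P.subOne h))
  have hrange' : Set.range (fun g => P.dualLeft g μ) = P.leftOrbit μ := by
    ext ν
    simp [leftOrbit, eq_comm]
  have h2 := sum_comp_mul_ncard_range (fun g => P.dualLeft g μ) (fun k g g' hg => by
    rw [dualLeft_mul, dualLeft_mul, hg]) (P.fixedTerm θ h)
  have h3 : ∑ x, θ (φ x (P.subOne h)) = (Fintype.card (P.patternGroup F) : ℂ) *
      ∑ g, P.fixedTerm θ h (P.dualLeft g μ) := by
    rw [Fintype.sum_prod_type, Finset.mul_sum]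
    refine Finset.sum_congr rfl fun g _ => ?_
    rw [← P.sum_dualRight_inv θ hθ h]
  rw [hrange, h3, Fintype.card_prod] at h1
  rw [hrange'] at h2
  have hc : (Fintype.card (P.patternGroup F) : ℂ) ≠ 0 := Nat.cast_ne_zero.2 Fintype.card_ne_zero
  have hT : ((P.twoSidedOrbit μ).ncard : ℂ) ≠ 0 := by
    have hmem : μ ∈ P.twoSidedOrbit μ := ⟨1, 1, by rw [dualLeft_one, dualRight_one]⟩
    exact Nat.cast_ne_zero.2 (Set.ncard_ne_zero_of_mem hmem (Set.toFinite _))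
  rw [superchar]
  push_cast at h1
  have h4 : ∑ᶠ ν ∈ P.twoSidedOrbit μ, θ (ν (P.subOne h)) =
      (∑ g, P.fixedTerm θ h (P.dualLeft g μ)) * ((P.twoSidedOrbit μ).ncard : ℂ) /
        (Fintype.card (P.patternGroup F) : ℂ) := by
    rw [eq_div_iff hc]
    refine mul_left_cancel₀ hc ?_
    linear_combination -h1
  rw [h4]
  field_simp
  linear_combination h2

theorem superchar_zero (θ : AddChar F ℂ) (hθ : θ ≠ 1) (h : P.patternGroup F) :
    P.superchar θ 0 h = 1 := by
  have : P.leftOrbit (0 : P.PatternDual F) = {0} := by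
    ext ν
    simp [leftOrbit, dualLeft]
  rw [superchar_eq_finsum P θ hθ, this, finsum_mem_singleton, fixedTerm, if_pos (by simp [dualLeft]),
    LinearMap.zero_apply, AddChar.map_zero_eq_one]

/-- If the left orbit of `μ₁ + μ₂` is the direct sum of those of `μ₁` and `μ₂`, then the
supercharacter of the sum is the product. -/
theorem superchar_add (θ : AddChar F ℂ) (hθ : θ ≠ 1) (μ₁ μ₂ : P.PatternDual F)
    (hsurj : ∀ g₁ g₂ : P.patternGroup F, ∃ g,
      μ₁.comp (P.mulLeft g) = μ₁.comp (P.mulLeft g₁) ∧ μ₂.comp (P.mulLeft g) = μ₂.comp (P.mulLeft g₂))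
    (hinj : ∀ ν₁ ∈ P.leftOrbit μ₁, ∀ ν₁' ∈ P.leftOrbit μ₁, ∀ ν₂ ∈ P.leftOrbit μ₂,
      ∀ ν₂' ∈ P.leftOrbit μ₂, ν₁ + ν₂ = ν₁' + ν₂' → ν₁ = ν₁')
    (h : P.patternGroup F) :
    P.superchar θ (μ₁ + μ₂) h = P.superchar θ μ₁ h * P.superchar θ μ₂ h := by
  classical
  simp only [superchar_eq_finsum P θ hθ]
  have hfin : ∀ s : Set (P.PatternDual F), s.Finite := fun s => s.toFinite
  rw [finsum_mem_eq_finite_toFinset_sum _ (hfin _), finsum_mem_eq_finite_toFinset_sum _ (hfin _),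
    finsum_mem_eq_finite_toFinset_sum _ (hfin _), Finset.sum_mul_sum, ← Finset.sum_product']
  symm
  refine Finset.sum_bij (fun x _ => x.1 + x.2) ?_ ?_ ?_ ?_
  · rintro ⟨ν₁, ν₂⟩ hν
    simp only [Finset.mem_product, Set.Finite.mem_toFinset, mem_leftOrbit_iff] at hν ⊢
    obtain ⟨⟨g₁, rfl⟩, g₂, rfl⟩ := hν
    obtain ⟨g, hg₁, hg₂⟩ := hsurj g₁ g₂
    exact ⟨g, by rw [← hg₁, ← hg₂, LinearMap.add_comp]⟩
  · rintro ⟨ν₁, ν₂⟩ hν ⟨ν₁', ν₂'⟩ hν' heq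
    simp only [Finset.mem_product, Set.Finite.mem_toFinset] at hν hν' heq
    have h1 := hinj _ hν.1 _ hν'.1 _ hν.2 _ hν'.2 heq
    rw [h1] at heq
    rw [h1, add_left_cancel heq]
  · intro ν hν
    simp only [Set.Finite.mem_toFinset] at hν
    obtain ⟨g, rfl⟩ := hν
    exact ⟨(P.dualLeft g μ₁, P.dualLeft g μ₂), by
      rw [Finset.mem_product, Set.Finite.mem_toFinset, Set.Finite.mem_toFinset]
      exact ⟨⟨g, rfl⟩, g, rfl⟩, rfl⟩
  · rintro ⟨ν₁, ν₂⟩ hν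
    simp only [Finset.mem_product, Set.Finite.mem_toFinset] at hν
    -- Because decompositions are unique, `h` fixes a sum only by fixing both summands; so the terms
    -- multiply.
    have hiff : P.dualLeft h (ν₁ + ν₂) = ν₁ + ν₂ ↔ P.dualLeft h ν₁ = ν₁ ∧ P.dualLeft h ν₂ = ν₂ := by
      constructor
      · intro heq
        rw [dualLeft_add] at heq
        have h1 := hinj _ (P.dualLeft_mem_leftOrbit h hν.1) _ hν.1 _
          (P.dualLeft_mem_leftOrbit h hν.2) _ hν.2 heq
        rw [h1] at heq
        exact ⟨h1, add_left_cancel heq⟩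
      · rintro ⟨h1, h2⟩
        rw [dualLeft_add, h1, h2]
    simp only [fixedTerm, hiff]
    by_cases h1 : P.dualLeft h ν₁ = ν₁ <;> by_cases h2 : P.dualLeft h ν₂ = ν₂ <;>
      simp [h1, h2, AddChar.map_add_eq_mul]

/-- The left action of `U_P` on the orbit `U_P μ`. -/
noncomputable def leftOrbitPerm (μ : P.PatternDual F) :
    P.patternGroup F →* Equiv.Perm (P.leftOrbit μ) where
  toFun g :=
    { toFun ν := ⟨P.dualLeft g ν, P.dualLeft_mem_leftOrbit g ν.2⟩
      invFun ν := ⟨P.dualLeft g⁻¹ ν, P.dualLeft_mem_leftOrbit g⁻¹ ν.2⟩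
      left_inv ν := Subtype.ext (by simp [← dualLeft_mul, dualLeft_one])
      right_inv ν := Subtype.ext (by simp [← dualLeft_mul, dualLeft_one]) }
  map_one' := Equiv.ext fun ν => Subtype.ext (P.dualLeft_one _)
  map_mul' g h := Equiv.ext fun ν => Subtype.ext (P.dualLeft_mul g h _)

theorem coe_leftOrbitPerm (μ : P.PatternDual F) (g : P.patternGroup F) (ν : P.leftOrbit μ) :
    (P.leftOrbitPerm μ g ν : P.PatternDual F) = P.dualLeft g ν := rfl

/-- The cocycle is `θ (ν (g - 1))`, and the cocycle identity comes from `gh - 1 = (g - 1) + g(h -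
1)`. The orbit is numbered by `Fin d` to match the definition of an irreducible character. -/
theorem isIrreducibleCharacter_superchar (θ : AddChar F ℂ) (hθ : θ ≠ 1) (μ : P.PatternDual F)
    (hsep : ∀ ν₁ ∈ P.leftOrbit μ, ∀ ν₂ ∈ P.leftOrbit μ, ν₁ ≠ ν₂ → ∃ g : P.patternGroup F,
      P.dualLeft g ν₁ = ν₁ ∧ P.dualLeft g ν₂ = ν₂ ∧ θ (ν₁ (P.subOne g)) ≠ θ (ν₂ (P.subOne g))) :
    IsIrreducibleCharacter (P.superchar θ μ) := by
  classical
  cases nonempty_fintype (P.leftOrbit μ)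
  let e := Fintype.equivFin (P.leftOrbit μ)
  let σ : P.patternGroup F →* Equiv.Perm (Fin (Fintype.card (P.leftOrbit μ))) :=
    e.permCongrHom.toMonoidHom.comp (P.leftOrbitPerm μ)
  have hσ : ∀ g i, σ g i = e (P.leftOrbitPerm μ g (e.symm i)) := fun _ _ => rfl
  have hmem : μ ∈ P.leftOrbit μ := ⟨1, (P.dualLeft_one μ).symm⟩
  let α : P.patternGroup F → Fin (Fintype.card (P.leftOrbit μ)) → ℂ :=
    fun g i => θ ((e.symm i).1 (P.subOne g))
  have h₁ : ∀ i, α 1 i = 1 := fun i => by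
    have : P.subOne (1 : P.patternGroup F) = 0 := Subtype.ext (by simp [subOne])
    simp [α, this]
  have hα : ∀ g h i, α (g * h) i = α g i * α h (σ g⁻¹ i) := fun g h i => by
    simp only [α, hσ, Equiv.symm_apply_apply, coe_leftOrbitPerm, dualLeft, inv_inv, subOne_mul,
      map_add, AddChar.map_add_eq_mul, LinearMap.comp_apply]
  have : Nonempty (Fin (Fintype.card (P.leftOrbit μ))) := ⟨e ⟨μ, hmem⟩⟩
  refine ⟨_, monomialRepresentation σ α h₁ hα,
    monomialRepresentation_isIrreducible σ α h₁ hα ?_ ?_, fun g => ?_⟩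
  · intro i j
    obtain ⟨k, hk⟩ := (e.symm i).2
    obtain ⟨l, hl⟩ := (e.symm j).2
    refine ⟨l * k⁻¹, ?_⟩
    rw [hσ, ← Equiv.eq_symm_apply]
    refine Subtype.ext ?_
    rw [coe_leftOrbitPerm, hk, ← dualLeft_mul, inv_mul_cancel_right, hl]
  · intro i j hij
    obtain ⟨g, hi, hj, hg⟩ := hsep _ (e.symm i).2 _ (e.symm j).2
      fun h => hij (e.symm.injective (Subtype.ext h))
    exact ⟨g, by rw [hσ, ← Equiv.eq_symm_apply]; exact Subtype.ext hi,
      by rw [hσ, ← Equiv.eq_symm_apply]; exact Subtype.ext hj, hg⟩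
  · rw [trace_monomialRepresentation, superchar_eq_finsum P θ hθ, ← finsum_set_coe_eq_finsum_mem,
      finsum_eq_sum_of_fintype, ← e.symm.sum_comp]
    refine Finset.sum_congr rfl fun i _ => ?_
    have : σ g i = i ↔ P.dualLeft g (e.symm i).1 = (e.symm i).1 := by
      rw [hσ, ← Equiv.eq_symm_apply, ← coe_leftOrbitPerm, Subtype.ext_iff]
    simp only [fixedTerm, this, α]

end Group

/-! ### Entries of functionals, and rank one functionals -/

section Coordinates

variable (P : PatternPoset n)

theorem eq_zero_of_not_rel {P : PatternPoset n} (X : P.patternAlgebra F) {i j : Fin n}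
    (h : ¬ P.rel i j) : X.1 i j = 0 := by_contra fun h' => h (X.2 i j h')

theorem ofEntries_apply (M : Fin n → Fin n → F) (X : P.patternAlgebra F) :
    P.ofEntries M X = ∑ i, ∑ j, M i j * X.1 i j := rfl

theorem ofEntries_congr {M N : Fin n → Fin n → F} (h : ∀ i j, P.rel i j → M i j = N i j) :
    P.ofEntries M = P.ofEntries N := by
  refine LinearMap.ext fun X => ?_
  rw [ofEntries_apply, ofEntries_apply]
  refine Finset.sum_congr rfl fun i _ => Finset.sum_congr rfl fun j _ => ?_
  by_cases hr : P.rel i j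
  · rw [h i j hr]
  · rw [eq_zero_of_not_rel X hr, mul_zero, mul_zero]

theorem ofEntries_single (M : Fin n → Fin n → F) {i j : Fin n} (h : P.rel i j) :
    P.ofEntries M ⟨Matrix.single i j 1, single_mem_patternAlgebra h⟩ = M i j := by
  rw [← P.entry_ofEntries M h, entry, dif_pos h]

theorem ofEntries_add (M N : Fin n → Fin n → F) :
    P.ofEntries M + P.ofEntries N = P.ofEntries (M + N) := by
  refine LinearMap.ext fun X => ?_
  simp only [LinearMap.add_apply, ofEntries_apply, Pi.add_apply, add_mul, Finset.sum_add_distrib]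

theorem ofEntries_entry (μ : P.PatternDual F) : P.ofEntries (P.entry μ) = μ := by
  classical
  refine LinearMap.ext fun X => ?_
  have hX : X = ∑ i, ∑ j, if h : P.rel i j then
      X.1 i j • (⟨Matrix.single i j 1, single_mem_patternAlgebra h⟩ : P.patternAlgebra F) else 0 := by
    refine Subtype.ext ?_
    rw [Submodule.coe_sum]
    conv_lhs => rw [Matrix.matrix_eq_sum_single X.1]
    refine Finset.sum_congr rfl fun i _ => ?_
    rw [Submodule.coe_sum]
    refine Finset.sum_congr rfl fun j _ => ?_
    by_cases h : P.rel i j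
    · rw [dif_pos h, Submodule.coe_smul, Matrix.smul_single, smul_eq_mul, mul_one]
    · rw [dif_neg h, eq_zero_of_not_rel X h, Matrix.single_zero, Submodule.coe_zero]
  conv_rhs => rw [hX]
  rw [ofEntries_apply, map_sum]
  refine Finset.sum_congr rfl fun i _ => ?_
  rw [map_sum]
  refine Finset.sum_congr rfl fun j _ => ?_
  by_cases h : P.rel i j
  · rw [dif_pos h, entry, dif_pos h, map_smul, smul_eq_mul, mul_comm]
  · rw [dif_neg h, eq_zero_of_not_rel X h, mul_zero, map_zero]

theorem entry_of_not_rel (μ : P.PatternDual F) {i j : Fin n} (h : ¬ P.rel i j) :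
    P.entry μ i j = 0 := dif_neg h

theorem entry_add (μ ν : P.PatternDual F) (i j : Fin n) :
    P.entry (μ + ν) i j = P.entry μ i j + P.entry ν i j := by
  by_cases h : P.rel i j
  · simp only [entry, dif_pos h, LinearMap.add_apply]
  · simp only [entry, dif_neg h, add_zero]

open scoped Classical in
theorem entry_part (S : Set (Fin n × Fin n)) (η : P.PatternDual F) {i j : Fin n}
    (h : P.rel i j) : P.entry (P.part S η) i j = if (i, j) ∈ S then P.entry η i j else 0 :=
  P.entry_ofEntries _ h

theorem mem_of_entry_part_ne_zero {S : Set (Fin n × Fin n)} {η : P.PatternDual F} {i j : Fin n}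
    (h : P.entry (P.part S η) i j ≠ 0) : (i, j) ∈ S := by
  by_contra hS
  by_cases hr : P.rel i j
  · exact h (by rw [entry_part P S η hr, if_neg hS])
  · exact h (P.entry_of_not_rel _ hr)

/-- The functional `X ↦ uᵀ X v`. -/
def rankOne (u v : Fin n → F) : P.PatternDual F := P.ofEntries fun i j => u i * v j

open Matrix in
theorem rankOne_apply (u v : Fin n → F) (X : P.patternAlgebra F) :
    P.rankOne u v X = (u ᵥ* X.1) ⬝ᵥ v := by
  rw [rankOne, ofEntries_apply, Finset.sum_comm]
  simp only [dotProduct, vecMul, Finset.sum_mul]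
  exact Finset.sum_congr rfl fun i _ => Finset.sum_congr rfl fun j _ => by ring

/-- Only positions `(j, k) ∈ P` with `k ≤ b` contribute, and by normality each of them forces `(j,
b) ∈ P`. -/
theorem rankOne_ext {P : PatternPoset n} (hP : P.IsNormal) {u₁ u₂ v : Fin n → F} {b : Fin n}
    (hv : ∀ k, v k ≠ 0 → k ≤ b) (h : ∀ j, P.rel j b → u₁ j = u₂ j) :
    P.rankOne u₁ v = P.rankOne u₂ v := by
  refine P.ofEntries_congr fun j k hjk => ?_
  by_cases hk : v k = 0
  · rw [hk, mul_zero, mul_zero]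
  · rw [h j (hP j j k b le_rfl (P.lt_of_rel hjk) (hv k hk) hjk)]

/-- When `supp λ` is a single position, `λ + ℜ_λ^*(η)` has rank one. -/
theorem add_rep_eq_rankOne (lam η : P.PatternDual F) {a b : Fin n} (hsupp : P.supp lam = {(a, b)}) :
    lam + P.rep lam η = P.rankOne
      (fun j => if j = a then 1 else
        P.entry (P.part (P.coauxL lam) η) j b * (P.entry lam a b)⁻¹)
      (fun k => if k = b then P.entry lam a b else
        P.entry (P.part (P.coauxR lam \ P.coauxL lam) η) a k) := by
  classical
  have hmem : ∀ i l, (i, l) ∈ P.supp lam ↔ i = a ∧ l = b := fun i l => by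
    rw [hsupp, Set.mem_singleton_iff, Prod.mk.injEq]
  have hc : P.entry lam a b ≠ 0 := ((hmem a b).2 ⟨rfl, rfl⟩).2
  rw [← P.ofEntries_entry (lam + P.rep lam η), rankOne]
  refine P.ofEntries_congr fun j k hjk => ?_
  rw [entry_add, rep, starProd, entry_ofEntries P _ hjk]
  set η₁ := P.part (P.coauxL lam) η
  set η₂ := P.part (P.coauxR lam \ P.coauxL lam) η
  have h₁ : ∀ j k, P.entry η₁ j k ≠ 0 → k = b ∧ a < j := by
    intro j k h
    obtain ⟨-, i, hi, hij⟩ := (P.mem_of_entry_part_ne_zero h).1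
    obtain ⟨rfl, rfl⟩ := (hmem _ _).1 hi
    exact ⟨rfl, hij⟩
  have h₂ : ∀ j k, P.entry η₂ j k ≠ 0 → j = a ∧ k < b := by
    intro j k h
    obtain ⟨-, l, hl, hkl⟩ := (P.mem_of_entry_part_ne_zero h).1.1
    obtain ⟨rfl, rfl⟩ := (hmem _ _).1 hl
    exact ⟨rfl, hkl⟩
  -- With `(a, b)` as the only position of `λ`, the correction is a single product, precisely the
  -- entry at `(j, k)` that rank one forces from row `a` and column `b`.
  have hsum : (∑ i, ∑ l, if i < j ∧ j < k ∧ k < l ∧ (i, l) ∈ P.supp lam then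
      P.entry η₁ j l * P.entry η₂ i k * (P.entry lam i l)⁻¹ else 0) =
      if a < j ∧ k < b then P.entry η₁ j b * P.entry η₂ a k * (P.entry lam a b)⁻¹ else 0 := by
    rw [Finset.sum_eq_single a, Finset.sum_eq_single b]
    · simp only [hmem, and_true, P.lt_of_rel hjk, true_and]
    · intro l _ hl
      exact if_neg fun h => hl ((hmem _ _).1 h.2.2.2).2
    · simp
    · intro i _ hi
      exact Finset.sum_eq_zero fun l _ => if_neg fun h => hi ((hmem _ _).1 h.2.2.2).1
    · simp
  have hlam : ¬ (j = a ∧ k = b) → P.entry lam j k = 0 := fun h => by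
    by_contra h'
    exact h ((hmem j k).1 ⟨hjk, h'⟩)
  rw [hsum]
  by_cases hj : j = a
  · subst hj
    have e₁ : P.entry η₁ j k = 0 := by_contra fun h => (h₁ _ _ h).2.false
    rw [if_pos rfl, if_neg fun h => h.1.false, e₁, one_mul, zero_add, add_zero]
    by_cases hk : k = b
    · subst hk
      have e₂ : P.entry η₂ j k = 0 := by_contra fun h => (h₂ _ _ h).2.false
      rw [if_pos rfl, e₂, add_zero]
    · rw [if_neg hk, hlam fun h => hk h.2, zero_add]
  · have e₂ : P.entry η₂ j k = 0 := by_contra fun h => hj (h₂ _ _ h).1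
    rw [if_neg hj, hlam fun h => hj h.1, e₂, zero_add, add_zero]
    by_cases hk : k = b
    · subst hk
      rw [if_pos rfl, if_neg fun h => h.2.false, add_zero, inv_mul_cancel_right₀ hc]
    · have e₁ : P.entry η₁ j k = 0 := by_contra fun h => hk (h₁ _ _ h).1
      rw [if_neg hk, e₁, zero_add]
      split_ifs with h
      · ring
      · by_cases haj : a < j
        · have : P.entry η₂ a k = 0 := by_contra fun h' => h ⟨haj, (h₂ _ _ h').2⟩
          rw [this, mul_zero]
        · have : P.entry η₁ j b = 0 := by_contra fun h' => haj (h₁ _ _ h').2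
          rw [this, zero_mul, zero_mul]

end Coordinates

/-! ### Rank one supercharacters: irreducibility, reduction to elementary form, and splitting off -/

section Group

variable [Finite F] (P : PatternPoset n)

open Matrix

theorem rankOne_comp_mulLeft (u v : Fin n → F) (g : P.patternGroup F) :
    (P.rankOne u v).comp (P.mulLeft g) = P.rankOne (u ᵥ* (g : GL (Fin n) F).val) v :=
  LinearMap.ext fun X => by
    rw [LinearMap.comp_apply, rankOne_apply, rankOne_apply, vecMul_vecMul]; rfl

theorem rankOne_comp_mulRight (u v : Fin n → F) (g : P.patternGroup F) :
    (P.rankOne u v).comp (P.mulRight g) = P.rankOne u ((g : GL (Fin n) F).val *ᵥ v) :=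
  LinearMap.ext fun X => by
    rw [LinearMap.comp_apply, rankOne_apply, rankOne_apply, dotProduct_mulVec, vecMul_vecMul]; rfl

theorem superchar_comp_mulLeft (θ : AddChar F ℂ) (μ : P.PatternDual F) (g : P.patternGroup F) :
    P.superchar θ (μ.comp (P.mulLeft g)) = P.superchar θ μ := by
  rw [← P.superchar_dualLeft θ g⁻¹ μ, dualLeft, inv_inv]

theorem superchar_comp_mulRight (θ : AddChar F ℂ) (μ : P.PatternDual F) (g : P.patternGroup F) :
    P.superchar θ (μ.comp (P.mulRight g)) = P.superchar θ μ := by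
  rw [← P.superchar_dualRight θ g⁻¹ μ, dualRight, inv_inv]

/-- Two distinct orbit points have left vectors differing at some `j` with `(j, b) ∈ P`. The element
`1 + s e_{jb}` alters a left vector only at index `b`, which `rankOne_ext` ignores, so it fixes both
points; their values on `s e_{jb}` differ. -/
theorem isIrreducibleCharacter_rankOne {P : PatternPoset n} (hP : P.IsNormal) {θ : AddChar F ℂ}
    (hθ : θ ≠ 1) (u : Fin n → F) {v : Fin n → F} {b : Fin n} (hb : v b ≠ 0)
    (hv : ∀ k, v k ≠ 0 → k ≤ b) : IsIrreducibleCharacter (P.superchar θ (P.rankOne u v)) := by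
  refine P.isIrreducibleCharacter_superchar θ hθ _ fun ν₁ h₁ ν₂ h₂ hne => ?_
  obtain ⟨g₁, rfl⟩ := P.mem_leftOrbit_iff.1 h₁
  obtain ⟨g₂, rfl⟩ := P.mem_leftOrbit_iff.1 h₂
  rw [rankOne_comp_mulLeft, rankOne_comp_mulLeft] at *
  set u₁ := u ᵥ* (g₁ : GL (Fin n) F).val
  set u₂ := u ᵥ* (g₂ : GL (Fin n) F).val
  obtain ⟨j, hjb, hj⟩ : ∃ j, P.rel j b ∧ u₁ j ≠ u₂ j := by
    by_contra! hc
    exact hne (rankOne_ext hP hv hc)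
  obtain ⟨t, ht⟩ := AddChar.ne_one_iff.1 hθ
  let E : P.patternAlgebra F := ⟨Matrix.single j b 1, single_mem_patternAlgebra hjb⟩
  -- Chosen so that the two values differ by exactly `t`, where `θ t ≠ 1`.
  let s : F := t * ((u₁ j - u₂ j) * v b)⁻¹
  have hfix : ∀ w : Fin n → F, P.dualLeft (P.oneAdd (s • E)) (P.rankOne w v) = P.rankOne w v := by
    intro w
    rw [dualLeft_eq_self_iff]
    intro Y
    rw [← LinearMap.comp_apply, rankOne_comp_mulLeft, coe_oneAdd]
    congr 1
    refine rankOne_ext hP hv fun i hi => ?_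
    have hib : b ≠ i := (P.lt_of_rel hi).ne'
    have : (w ᵥ* (s • Matrix.single j b (1 : F))) i = 0 := by
      rw [vecMul_smul, Pi.smul_apply, vecMul, dotProduct, Finset.sum_eq_zero, smul_zero]
      intro k _
      rw [single_apply_of_ne _ _ _ _ _ fun h => hib h.2, mul_zero]
    rw [vecMul_add, vecMul_one, Pi.add_apply]
    change w i + (w ᵥ* (s • Matrix.single j b (1 : F))) i = w i
    rw [this, add_zero]
  have hval : ∀ w : Fin n → F, P.rankOne w v (P.subOne (P.oneAdd (s • E))) = s * (w j * v b) := by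
    intro w
    rw [subOne_oneAdd, map_smul, rankOne, ofEntries_single P _ hjb, smul_eq_mul]
  refine ⟨P.oneAdd (s • E), hfix _, hfix _, fun heq => ht ?_⟩
  rw [hval, hval] at heq
  have h1 : t = s * (u₁ j * v b) - s * (u₂ j * v b) := by
    rw [← mul_sub, ← sub_mul, inv_mul_cancel_right₀ (mul_ne_zero (sub_ne_zero.2 hj) hb)]
  have h2 := θ.map_add_eq_mul t (s * (u₂ j * v b))
  rw [h1, sub_add_cancel, ← h1, heq] at h2
  refine (mul_eq_right₀ fun h0 => ?_).1 h2.symm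
  have h3 := θ.map_add_eq_mul (s * (u₂ j * v b)) (-(s * (u₂ j * v b)))
  rw [h0, zero_mul, add_neg_cancel, θ.map_zero_eq_one] at h3
  exact one_ne_zero h3

theorem IsElementary.isIrreducibleCharacter {P : PatternPoset n} (hP : P.IsNormal)
    {θ : AddChar F ℂ} (hθ : θ ≠ 1) {χ : P.patternGroup F → ℂ} (hχ : P.IsElementary θ χ) :
    IsIrreducibleCharacter χ := by
  obtain ⟨lam, η, -, hcard, -, rfl⟩ := hχ
  obtain ⟨⟨a, b⟩, hab⟩ := Set.ncard_eq_one.1 hcard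
  have hmem : (a, b) ∈ P.supp lam := hab ▸ rfl
  rw [P.add_rep_eq_rankOne lam η hab]
  refine isIrreducibleCharacter_rankOne hP hθ _ (b := b) ?_ fun k hk => ?_
  · rw [if_pos rfl]
    exact hmem.2
  · by_cases hkb : k = b
    · exact hkb.le
    · rw [if_neg hkb] at hk
      obtain ⟨-, l, hl, hkl⟩ := (P.mem_of_entry_part_ne_zero hk).1.1
      rw [hab] at hl
      have : l = b := (Prod.mk.inj hl).2
      exact (this ▸ hkl : k < b).le

-- Here `λ` is the corner `(a, b)` of the rank one matrix, and `η` the rest of row `a` and column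
-- `b`. The conditions on `u` and `v` keep `η` off `coadj_P(λ)`, and the remaining entries agree
-- because both functionals have rank one.
open scoped Classical in
theorem isElementary_of_reduced {P : PatternPoset n} (hP : P.IsNormal) (θ : AddChar F ℂ)
    {u v : Fin n → F} {a b : Fin n} (hab : P.rel a b) (ha : u a ≠ 0) (hb : v b ≠ 0)
    (hu : ∀ j, u j ≠ 0 → j = a ∨ a < j ∧ ¬ P.rel a j)
    (hv : ∀ k, v k ≠ 0 → k = b ∨ k < b ∧ ¬ P.rel k b) :
    P.IsElementary θ (P.superchar θ (P.rankOne u v)) := by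
  set lam : P.PatternDual F := P.ofEntries fun j k => if j = a ∧ k = b then u a * v b else 0
  set η : P.PatternDual F := P.ofEntries fun j k =>
    if (j = a ∧ k ≠ b) ∨ (j ≠ a ∧ k = b) then u j * v k else 0 with hη
  have hlam : P.entry lam a b = u a * v b := by
    rw [P.entry_ofEntries _ hab, if_pos ⟨rfl, rfl⟩]
  have hmem : ∀ j k, (j, k) ∈ P.supp lam ↔ j = a ∧ k = b := by
    intro j k
    constructor
    · rintro ⟨hr, h⟩
      rw [P.entry_ofEntries _ hr] at h
      by_contra hc
      exact h (if_neg hc)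
    · rintro ⟨rfl, rfl⟩
      exact ⟨hab, by rw [hlam]; exact mul_ne_zero ha hb⟩
  have hsupp : P.supp lam = {(a, b)} := by
    ext ⟨j, k⟩
    rw [hmem, Set.mem_singleton_iff, Prod.mk.injEq]
  have hL : ∀ j, P.rel j b → j ≠ a → u j ≠ 0 → (j, b) ∈ P.coauxL lam ∧ (j, b) ∈ P.coaux lam := by
    intro j hr hj huj
    obtain ⟨haj, hnr⟩ := (hu j huj).resolve_left hj
    have h1 : (j, b) ∈ P.coadjL (full n) lam := ⟨hr, a, (hmem _ _).2 ⟨rfl, rfl⟩, haj⟩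
    have h2 : (j, b) ∉ P.coadjL P lam := by
      rintro ⟨-, i, hi, hij⟩
      obtain ⟨rfl, -⟩ := (hmem _ _).1 hi
      exact hnr hij
    refine ⟨⟨h1, h2⟩, Or.inl h1, ?_⟩
    rintro (h | ⟨-, k, hk, -⟩)
    · exact h2 h
    · exact hj ((hmem _ _).1 hk).1
  have hR : ∀ k, P.rel a k → k ≠ b → v k ≠ 0 →
      (a, k) ∈ P.coauxR lam \ P.coauxL lam ∧ (a, k) ∈ P.coaux lam := by
    intro k hr hk hvk
    obtain ⟨hkb, hnr⟩ := (hv k hvk).resolve_left hk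
    have h1 : (a, k) ∈ P.coadjR (full n) lam := ⟨hr, b, (hmem _ _).2 ⟨rfl, rfl⟩, hkb⟩
    have h2 : (a, k) ∉ P.coadjR P lam := by
      rintro ⟨-, l, hl, hkl⟩
      obtain ⟨-, rfl⟩ := (hmem _ _).1 hl
      exact hnr hkl
    have h3 : ∀ Q : PatternPoset n, (a, k) ∉ P.coadjL Q lam := by
      rintro Q ⟨-, i, hi, -⟩
      exact hk ((hmem _ _).1 hi).2
    refine ⟨⟨⟨h1, h2⟩, fun h => h3 _ h.1⟩, Or.inr h1, ?_⟩
    rintro (h | h)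
    · exact h3 _ h
    · exact h2 h
  have hE₁ : ∀ j, P.rel j b → j ≠ a → P.entry (P.part (P.coauxL lam) η) j b = u j * v b := by
    intro j hr hj
    rw [P.entry_part _ _ hr, P.entry_ofEntries _ hr, if_pos (Or.inr ⟨hj, rfl⟩)]
    by_cases huj : u j = 0
    · rw [huj, zero_mul, ite_self]
    · rw [if_pos (hL j hr hj huj).1]
  have hE₂ : ∀ k, P.rel a k → k ≠ b →
      P.entry (P.part (P.coauxR lam \ P.coauxL lam) η) a k = u a * v k := by
    intro k hr hk
    rw [P.entry_part _ _ hr, P.entry_ofEntries _ hr, if_pos (Or.inl ⟨rfl, hk⟩)]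
    by_cases hvk : v k = 0
    · rw [hvk, mul_zero, ite_self]
    · rw [if_pos (hR k hr hk hvk).1]
  refine ⟨lam, η, ?_, ?_, ?_, ?_⟩
  · rw [IsSetPartition, hsupp]
    rintro p rfl q rfl -
    rfl
  · rw [hsupp, Set.ncard_singleton]
  · rintro ⟨j, k⟩ ⟨hr, h⟩
    rw [hη, P.entry_ofEntries _ hr] at h
    obtain ⟨hc, h'⟩ := Classical.not_imp.1 fun hc => h (ite_eq_right_iff.2 hc)
    rcases hc with ⟨rfl, hk⟩ | ⟨hj, rfl⟩
    · exact (hR k hr hk (right_ne_zero_of_mul h')).2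
    · exact (hL j hr hj (left_ne_zero_of_mul h')).2
  · rw [P.add_rep_eq_rankOne lam η hsupp, hlam]
    congr 1
    refine P.ofEntries_congr fun j k hjk => ?_
    by_cases hj : j = a <;> by_cases hk : k = b
    · subst hj; subst hk
      simp
    · subst hj
      simp only [if_true, if_neg hk, hE₂ k hjk hk, one_mul]
    · subst hk
      simp only [if_true, if_neg hj, hE₁ j hjk hj, inv_mul_cancel_right₀ (mul_ne_zero ha hb)]
    · simp only [if_neg hj, if_neg hk]
      by_cases huj : u j = 0
      · have : P.entry (P.part (P.coauxL lam) η) j b = 0 := by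
          by_cases hr : P.rel j b
          · rw [hE₁ j hr hj, huj, zero_mul]
          · exact P.entry_of_not_rel _ hr
        rw [huj, this, zero_mul, zero_mul, zero_mul]
      by_cases hvk : v k = 0
      · have : P.entry (P.part (P.coauxR lam \ P.coauxL lam) η) a k = 0 := by
          by_cases hr : P.rel a k
          · rw [hE₂ k hr hk, hvk, mul_zero]
          · exact P.entry_of_not_rel _ hr
        rw [hvk, this, mul_zero, mul_zero]
      have haj := ((hu j huj).resolve_left hj).1
      have hkb := ((hv k hvk).resolve_left hk).1
      have hlt := P.lt_of_rel hjk
      -- Normality puts `(j, b)` and `(a, k)` in `P`, so `η` really carries the two entries whose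
      -- product is needed.
      rw [hE₁ j (hP j j k b le_rfl hlt hkb.le hjk) hj, hE₂ k (hP a j k k haj.le hlt le_rfl hjk) hk]
      field_simp

-- Elimination within the orbit: `1 + Y`, with `Y` living in row `a`, clears `u` at every `k` with
-- `(a, k) ∈ P`, and `1 + Z`, with `Z` living in column `b`, clears `v` at every `k` with `(k, b) ∈
-- P`. What is left is reduced.
open scoped Classical in
theorem isElementary_rankOne {P : PatternPoset n} (hP : P.IsNormal) (θ : AddChar F ℂ)
    {u v : Fin n → F} {a b : Fin n} (hab : P.rel a b) (ha : u a ≠ 0) (hb : v b ≠ 0)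
    (hu : ∀ j, u j ≠ 0 → a ≤ j) (hv : ∀ k, v k ≠ 0 → k ≤ b) :
    P.IsElementary θ (P.superchar θ (P.rankOne u v)) := by
  let Y : P.patternAlgebra F :=
    ⟨fun i k => if i = a ∧ P.rel a k then -(u k * (u a)⁻¹) else 0, fun i k h => by
      by_contra hr
      exact h (if_neg fun h' : i = a ∧ P.rel a k => hr (h'.1 ▸ h'.2))⟩
  let Z : P.patternAlgebra F :=
    ⟨fun i k => if k = b ∧ P.rel i b then -(v i * (v b)⁻¹) else 0, fun i k h => by
      by_contra hr
      exact h (if_neg fun h' : k = b ∧ P.rel i b => hr (h'.1 ▸ h'.2))⟩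
  have hY : ∀ k, (u ᵥ* (1 + Y.1)) k = if P.rel a k then 0 else u k := by
    intro k
    have : (u ᵥ* Y.1) k = if P.rel a k then -u k else 0 := by
      rw [vecMul, dotProduct, Finset.sum_eq_single a]
      · by_cases hr : P.rel a k
        · simp only [Y, hr, and_self, if_true]
          field_simp
        · simp [Y, hr]
      · intro i _ hi
        simp [Y, hi]
      · simp
    rw [vecMul_add, vecMul_one, Pi.add_apply, this]
    split_ifs <;> simp
  have hZ : ∀ k, ((1 + Z.1) *ᵥ v) k = if P.rel k b then 0 else v k := by
    intro k
    have : (Z.1 *ᵥ v) k = if P.rel k b then -v k else 0 := by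
      rw [mulVec, dotProduct, Finset.sum_eq_single b]
      · by_cases hr : P.rel k b
        · simp only [Z, hr, and_self, if_true]
          field_simp
        · simp [Z, hr]
      · intro i _ hi
        simp [Z, hi]
      · simp
    rw [add_mulVec, one_mulVec, Pi.add_apply, this]
    split_ifs <;> simp
  rw [← P.superchar_comp_mulLeft θ _ (P.oneAdd Y), rankOne_comp_mulLeft,
    ← P.superchar_comp_mulRight θ _ (P.oneAdd Z), rankOne_comp_mulRight, coe_oneAdd, coe_oneAdd]
  refine isElementary_of_reduced hP θ hab ?_ ?_ ?_ ?_
  · rwa [hY, if_neg fun h => (P.lt_of_rel h).false]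
  · rwa [hZ, if_neg fun h => (P.lt_of_rel h).false]
  · intro j hj
    rw [hY] at hj
    obtain ⟨hr, hj⟩ := ite_ne_left_iff.1 hj
    exact (hu j hj.symm).eq_or_lt.imp Eq.symm fun h => ⟨h, hr⟩
  · intro k hk
    rw [hZ] at hk
    obtain ⟨hr, hk⟩ := ite_ne_left_iff.1 hk
    exact (hv k hk.symm).eq_or_lt.imp id fun h => ⟨h, hr⟩

/-- Splitting off a rank one functional whose leading row and column do not meet the rest. -/
theorem superchar_rankOne_add {P : PatternPoset n} (hP : P.IsNormal) {θ : AddChar F ℂ} (hθ : θ ≠ 1)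
    {u v : Fin n → F} {a b : Fin n} (ha : u a ≠ 0) (hb : v b ≠ 0)
    (hu : ∀ j, u j ≠ 0 → a ≤ j) (hv : ∀ k, v k ≠ 0 → k ≤ b) {M : Fin n → Fin n → F}
    (hMa : ∀ k, M a k = 0) (hMb : ∀ j, M j b = 0) (h : P.patternGroup F) :
    P.superchar θ (P.rankOne u v + P.ofEntries M) h =
      P.superchar θ (P.rankOne u v) h * P.superchar θ (P.ofEntries M) h := by
  classical
  refine P.superchar_add θ hθ _ _ ?_ ?_ h
  · intro g₁ g₂
    -- The functional `M` does not see row `a` of the group element. So take all other rows from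
    -- `g₂` and solve for row `a` so that `u` is moved as by `g₁`.
    let r : Fin n → F := fun k => (u a)⁻¹ *
      ((u ᵥ* (P.subOne g₁).1) k - ∑ i ∈ Finset.univ.erase a, u i * (P.subOne g₂).1 i k)
    let Y : P.patternAlgebra F := ⟨fun i k => if i = a then r k else (P.subOne g₂).1 i k, by
      intro i k hik
      by_cases hi : i = a
      · subst hi
        by_contra hr
        -- The new row stays inside `P`: as `u` lives on indices `≥ a`, normality shows that if `(a,
        -- k) ∉ P` then no relevant `(j, k)` is in `P`.
        have h0 : ∀ (X : P.patternAlgebra F) j, u j * X.1 j k = 0 := by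
          intro X j
          by_contra hj
          have hjk := X.2 _ _ (right_ne_zero_of_mul hj)
          exact hr (hP i j k k (hu j (left_ne_zero_of_mul hj)) (P.lt_of_rel hjk) le_rfl hjk)
        refine hik ?_
        simp only [if_true, r, vecMul, dotProduct, h0, Finset.sum_const_zero, sub_zero, mul_zero]
      · simp only [if_neg hi] at hik
        exact (P.subOne g₂).2 _ _ hik⟩
    refine ⟨P.oneAdd Y, ?_, ?_⟩
    · rw [rankOne_comp_mulLeft, rankOne_comp_mulLeft]
      congr 1
      have h1 : (g₁ : GL (Fin n) F).val = 1 + (P.subOne g₁).1 := by simp [subOne]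
      rw [coe_oneAdd, h1, vecMul_add, vecMul_add]
      congr 1
      ext k
      conv_lhs => rw [vecMul, dotProduct, ← Finset.add_sum_erase _ _ (Finset.mem_univ a)]
      have h2 : ∑ i ∈ Finset.univ.erase a, u i * Y.1 i k =
          ∑ i ∈ Finset.univ.erase a, u i * (P.subOne g₂).1 i k :=
        Finset.sum_congr rfl fun i hi => by simp [Y, Finset.ne_of_mem_erase hi]
      rw [h2]
      simp only [Y, if_true, r]
      rw [mul_inv_cancel_left₀ ha, sub_add_cancel]
    · have hrow : ∀ i, i ≠ a → (1 + Y.1) i = (g₂ : GL (Fin n) F).val i := by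
        intro i hi
        ext k
        rw [Matrix.add_apply]
        change (1 : Matrix (Fin n) (Fin n) F) i k + (if i = a then r k else (P.subOne g₂).1 i k) = _
        rw [if_neg hi]
        simp [subOne]
      refine LinearMap.ext fun X => ?_
      rw [LinearMap.comp_apply, LinearMap.comp_apply, ofEntries_apply, ofEntries_apply]
      refine Finset.sum_congr rfl fun i _ => Finset.sum_congr rfl fun k _ => ?_
      by_cases hi : i = a
      · rw [hi, hMa, zero_mul, zero_mul]
      · congr 1
        change ((1 + Y.1) * X.1) i k = ((g₂ : GL (Fin n) F).val * X.1) i k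
        rw [Matrix.mul_apply, Matrix.mul_apply, hrow i hi]
  · intro ν₁ h₁ ν₁' h₁' ν₂ h₂ ν₂' h₂' heq
    obtain ⟨g₁, rfl⟩ := P.mem_leftOrbit_iff.1 h₁
    obtain ⟨g₁', rfl⟩ := P.mem_leftOrbit_iff.1 h₁'
    obtain ⟨g₂, rfl⟩ := P.mem_leftOrbit_iff.1 h₂
    obtain ⟨g₂', rfl⟩ := P.mem_leftOrbit_iff.1 h₂'
    rw [rankOne_comp_mulLeft, rankOne_comp_mulLeft] at heq ⊢
    refine rankOne_ext hP hv fun j hj => ?_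
    -- The left action preserves the vanishing of column `b`, so column `b` of the sum recovers the
    -- rank one part.
    have h0 : ∀ g : P.patternGroup F, (P.ofEntries M).comp (P.mulLeft g)
        ⟨Matrix.single j b 1, single_mem_patternAlgebra hj⟩ = 0 := by
      intro g
      rw [LinearMap.comp_apply, ofEntries_apply]
      refine Finset.sum_eq_zero fun i _ => Finset.sum_eq_zero fun k _ => ?_
      by_cases hk : k = b
      · rw [hk, hMb, zero_mul]
      · change M i k * ((g : GL (Fin n) F).val * Matrix.single j b (1 : F) :
          Matrix (Fin n) (Fin n) F) i k = 0
        rw [Matrix.mul_single_apply_of_ne _ _ _ _ _ hk, mul_zero]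
    have h1 := LinearMap.congr_fun heq ⟨Matrix.single j b 1, single_mem_patternAlgebra hj⟩
    rw [LinearMap.add_apply, LinearMap.add_apply, h0, h0, add_zero, add_zero, rankOne, rankOne,
      ofEntries_single P _ hj, ofEntries_single P _ hj] at h1
    exact mul_right_cancel₀ hb h1

/-- The induction runs over arbitrary matrices, not just ones supported in `P`: subtracting a rank
one matrix may create entries outside `P`, which the functional ignores. -/
theorem exists_prod_isElementary {P : PatternPoset n} (hP : P.IsNormal) {θ : AddChar F ℂ}
    (hθ : θ ≠ 1) (m : ℕ) (M : Fin n → Fin n → F) (hM : ∀ i j : Fin n, m ≤ j → M i j = 0) :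
    ∃ L : List (P.patternGroup F → ℂ), (∀ ψ ∈ L, P.IsElementary θ ψ) ∧
      ∀ g, P.superchar θ (P.ofEntries M) g = (L.map fun ψ => ψ g).prod := by
  induction m generalizing M with
  | zero =>
    have h0 : P.ofEntries M = 0 := LinearMap.ext fun X => by
      rw [ofEntries_apply]
      simp [hM]
    exact ⟨[], by simp, fun g => by rw [h0, superchar_zero P θ hθ]; rfl⟩
  | succ m ih =>
    by_cases hcol : ∀ i j : Fin n, (j : ℕ) = m → M i j = 0
    · refine ih M fun i j hj => ?_
      rcases hj.eq_or_lt with h | h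
      · exact hcol i j h.symm
      · exact hM i j h
    · push Not at hcol
      obtain ⟨i₀, b, hbm, hi₀⟩ := hcol
      obtain ⟨a, ha, hmin⟩ : ∃ a, M a b ≠ 0 ∧ ∀ j, M j b ≠ 0 → a ≤ j := by
        obtain ⟨a, ha, hmin⟩ := (Set.toFinite {i | M i b ≠ 0}).exists_minimal ⟨i₀, hi₀⟩
        exact ⟨a, ha, fun j hj => (le_total a j).elim id fun h => hmin hj h⟩
      let u : Fin n → F := fun j => M j b
      let v : Fin n → F := fun k => M a k * (M a b)⁻¹
      have hb : v b ≠ 0 := mul_ne_zero ha (inv_ne_zero ha)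
      have hv : ∀ k, v k ≠ 0 → k ≤ b := by
        intro k hk
        by_contra! hlt
        refine left_ne_zero_of_mul hk (hM a k ?_)
        have : (b : ℕ) < k := hlt
        omega
      -- The Schur complement of the pivot `(a, b)`.
      let M' : Fin n → Fin n → F := fun j k => M j k - u j * v k
      have hMa : ∀ k, M' a k = 0 := fun k => by
        simp only [M', u, v]
        field_simp
        ring
      have hMb : ∀ j, M' j b = 0 := fun j => by
        simp only [M', u, v]
        field_simp
        ring
      have hsplit : P.ofEntries M = P.rankOne u v + P.ofEntries M' := by
        rw [rankOne, ofEntries_add]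
        congr 1
        ext j k
        simp [M']
      obtain ⟨L, hL, hprod⟩ := ih M' fun i j hj => by
        rcases hj.eq_or_lt with h | h
        · rw [Fin.ext (h.symm.trans hbm.symm), hMb]
        · simp only [M', u, v, hM _ j h, zero_mul, mul_zero, sub_zero]
      by_cases hab : P.rel a b
      · refine ⟨P.superchar θ (P.rankOne u v) :: L, ?_, fun g => ?_⟩
        · intro ψ hψ
          rcases List.mem_cons.1 hψ with rfl | hψ
          · exact isElementary_rankOne hP θ (u := u) hab ha hb hmin hv
          · exact hL ψ hψ
        · rw [hsplit, superchar_rankOne_add hP hθ (u := u) ha hb hmin hv hMa hMb, hprod, List.map_cons,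
            List.prod_cons]
      -- A nonzero entry at `(j, k) ∈ P` would have `a ≤ j < k ≤ b`, and normality would put the
      -- pivot in `P`.
      · have h0 : P.rankOne u v = 0 := by
          have h1 : P.rankOne u v = P.ofEntries fun _ _ => 0 := by
            refine P.ofEntries_congr fun j k hjk => ?_
            by_contra hne
            exact hab (hP a j k b (hmin j (left_ne_zero_of_mul hne)) (P.lt_of_rel hjk)
              (hv k (right_ne_zero_of_mul hne)) hjk)
          rw [h1]
          exact LinearMap.ext fun X => by rw [ofEntries_apply]; simp
        exact ⟨L, hL, fun g => by rw [hsplit, h0, zero_add, hprod]⟩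

end Group

end PatternPoset

theorem mainTheorem4 {F : Type*} [Field F] [Finite F] {n : ℕ} (P : PatternPoset n)
    (hP : P.IsNormal) (θ : AddChar F ℂ) (hθ : θ ≠ 1) :
    (∀ ψ : P.patternGroup F → ℂ, P.IsElementary θ ψ → IsIrreducibleCharacter ψ) ∧
    (∀ χ : P.patternGroup F → ℂ, P.IsSupercharacter θ χ →
      ∃ L : List (P.patternGroup F → ℂ), (∀ ψ ∈ L, P.IsElementary θ ψ) ∧
        ∀ g, χ g = (L.map fun ψ => ψ g).prod) := by
  refine ⟨fun ψ hψ => hψ.isIrreducibleCharacter hP hθ, ?_⟩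
  rintro χ ⟨μ, rfl⟩
  rw [← P.ofEntries_entry μ]
  exact PatternPoset.exists_prod_isElementary hP hθ n _ fun i j hj => absurd j.2 hj.not_gt
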